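/- Let $R$ be a commutative Noetherian ring, $\mathfrak a\subsetneq R$ a proper ideal, $M$ a finitely generated $R$-module, and $$F=\ \cdots\to F_n\xrightarrow{\lambda_n}F_{n-1}\to\cdots\to F_1\xrightarrow{\lambda_1}F_0\xrightarrow{\lambda_0}M\to0$$ a (possibly infinite) resolution of $M$ by finitely generated free $R$-modules. Put $\Omega_0(M)=M$ and $\Omega_n(M)=\ker\lambda_{n-1}$ for $n\ge1$. For an $R$-module $N$ let $\operatorname{grade}(\mathfrak a,N)$ be the least, and $\operatorname{cd}(\mathfrak a,N)$ the largest, integer $i$ such that the local cohomology module $H^i_{\mathfrak a}(N)$ is nonzero (with $\operatorname{grade}(\mathfrak a,N)=\infty$ and $\operatorname{cd}(\mathfrak a,N)=-\infty$ if there is no such $i$). A finitely generated $R$-module $N$ is called $\mathfrak a$-RCM (relative Cohen–Macaulay with respect to $\mathfrak a$) if $H^i_{\mathfrak a}(N)\neq0$ for exactly one $i$; it is called maximal $\mathfrak a$-RCM if moreover $N\ne0$ and $\operatorname{cd}(\mathfrak a,N)=\operatorname{cd}(\mathfrak a,R)$. Then the following hold. (i) $\operatorname{grade}(\mathfrak a,\Omega_n(M))\ge\min\{n,\operatorname{grade}(\mathfrak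 a,R)\}$ for all $n\ge0$. (ii) Suppose that $R$ is $\mathfrak a$-RCM. Then for every $n\ge\operatorname{cd}(\mathfrak a,R)$, either $\mathfrak a\,\Omega_n(M)=\Omega_n(M)$ or $\Omega_n(M)$ is maximal $\mathfrak a$-RCM. In particular, if $\mathfrak a$ is contained in the Jacobson radical of $R$ (for instance, if $R$ is local), then $\Omega_n(M)$ is zero or maximal $\mathfrak a$-RCM for all $n\ge\operatorname{cd}(\mathfrak a,R)$. -/

import Mathlib

universe u

namespace RelativeCM

open CategoryTheory CategoryTheory.Limits

section LocalCohomologyInvariants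

variable {R : Type u} [CommRing R]

/-- The `i`-th local cohomology module of `N` with respect to `a` is nonzero. -/
def NonvanishingAt (a : Ideal R) (N : ModuleCat.{u} R) (i : ℕ) : Prop :=
  ¬ IsZero ((localCohomology a i).obj N)

/-- `grade(a, N)`: the least `i` for which the `i`-th local cohomology module of `N` with respect
to `a` is nonzero, and `∞` if there is no such `i`. -/
noncomputable def grade (a : Ideal R) (N : ModuleCat.{u} R) : ℕ∞ :=
  ⨅ (i : ℕ) (_ : NonvanishingAt a N i), (i : ℕ∞)

/-- `cd(a, N)`: the largest `i` for which the `i`-th local cohomology module of `N` with respect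
to `a` is nonzero, `-∞` if there is no such `i` (and `∞` if these `i` were unbounded). -/
noncomputable def cd (a : Ideal R) (N : ModuleCat.{u} R) : WithBot ℕ∞ :=
  ⨆ (i : ℕ) (_ : NonvanishingAt a N i), ((i : ℕ∞) : WithBot ℕ∞)

/-- `N` is relative Cohen-Macaulay with respect to `a`: it is finitely generated and precisely one
of its local cohomology modules with respect to `a` is nonzero. -/
structure IsRCM (a : Ideal R) (N : ModuleCat.{u} R) : Prop where
  finite : Module.Finite R N
  existsUnique : ∃! i : ℕ, NonvanishingAt a N i

/-- `N` is maximal relative Cohen-Macaulay with respect to `a`: it is nonzero, relative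
Cohen-Macaulay with respect to `a`, and `cd(a, N) = cd(a, R)`. -/
structure IsMaximalRCM (a : Ideal R) (N : ModuleCat.{u} R) : Prop where
  nontrivial : Nontrivial N
  isRCM : IsRCM a N
  cd_eq : cd a N = cd a (ModuleCat.of R R)

end LocalCohomologyInvariants

/-- A (possibly infinite) resolution
`⋯ ⟶ F (n + 1) ⟶ F n ⟶ ⋯ ⟶ F 1 ⟶ F 0 ⟶ M ⟶ 0` of `M` by finitely generated free modules. -/
structure FiniteFreeResolution (R : Type u) [CommRing R] (M : Type u) [AddCommGroup M]
    [Module R M] where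
  /-- The terms of the resolution. -/
  F : ℕ → Type u
  [addCommGroup : ∀ n, AddCommGroup (F n)]
  [module : ∀ n, Module R (F n)]
  [free : ∀ n, Module.Free R (F n)]
  [finite : ∀ n, Module.Finite R (F n)]
  /-- The differentials. -/
  d : ∀ n, F (n + 1) →ₗ[R] F n
  /-- The augmentation. -/
  ε : F 0 →ₗ[R] M
  surjective_ε : Function.Surjective ε
  exact_zero : Function.Exact (d 0) ε
  exact_succ : ∀ n, Function.Exact (d (n + 1)) (d n)

attribute [instance] FiniteFreeResolution.addCommGroup FiniteFreeResolution.module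
  FiniteFreeResolution.free FiniteFreeResolution.finite

/-- The `n`-th syzygy: `M` itself for `n = 0`, the kernel of `F 0 ⟶ M` for `n = 1`, and the kernel
of `F (n - 1) ⟶ F (n - 2)` for `n ≥ 2`. -/
def FiniteFreeResolution.syzygy {R : Type u} [CommRing R] {M : Type u} [AddCommGroup M]
    [Module R M] (P : FiniteFreeResolution R M) : ℕ → ModuleCat.{u} R
  | 0 => ModuleCat.of R M
  | 1 => ModuleCat.of R (LinearMap.ker P.ε)
  | n + 2 => ModuleCat.of R (LinearMap.ker (P.d n))

end RelativeCM

/-! The module $H^i_{\mathfrak a}(N)$ is the filtered colimit of $\operatorname{Ext}^i(R/\mathfrak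
a^t,N)$, so it vanishes iff every class dies after restriction to a deeper quotient.
`ExtColimVanishes` records this condition, and the long exact sequences of Ext carry over to it.

Part (i) is dimension shifting along $0\to\Omega_{n+1}\to F_n\to\Omega_n\to0$: below the grade of
$R$ the free modules contribute nothing, and each syzygy step gains one degree of vanishing
(`extColimVanishes_syzygy`).

For (ii), let $d$ be the only degree where $H^i_{\mathfrak a}(R)\ne0$, and let $n\ge d$. Degrees
below $d$ vanish on $\Omega_n$ by the same shifting. Degrees above $d$ vanish on every finitely
generated module by descending induction (`extColimVanishes_of_forall_gt`), started by a bound valid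
for all modules (`exists_extColimVanishes_of_lt`). If $\mathfrak a\Omega_n\ne\Omega_n$, some degree
survives (`exists_not_extColimVanishes`), and it must be $d$. Nakayama's lemma gives the Jacobson
radical case. -/

namespace RelativeCM

open CategoryTheory CategoryTheory.Limits Opposite

/-! ### Cocycle representatives for homology in the opposite category -/

section OppositeComplex

universe v

variable {R : Type*} [Ring R] {K L : ChainComplex (ModuleCat.{v} R)ᵒᵖ ℕ}

/-- The cochain `c` of the opposite complex is a cocycle representing the cohomology class `h`. -/
def Represents (K : ChainComplex (ModuleCat.{v} R)ᵒᵖ ℕ) (n : ℕ) (c : (K.X n).unop)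
    (h : (K.homology n).unop) : Prop :=
  ∃ z : (K.opcycles n).unop, (K.pOpcycles n).unop z = c ∧ (K.homologyι n).unop z = h

lemma exists_represents (n : ℕ) (h : (K.homology n).unop) :
    ∃ c, Represents K n c h := by
  have : Function.Surjective (K.homologyι n).unop :=
    (ModuleCat.epi_iff_surjective _).1 inferInstance
  obtain ⟨z, rfl⟩ := this h
  exact ⟨_, z, rfl, rfl⟩

lemma exists_represents_iff (n : ℕ) (c : (K.X n).unop) :
    (∃ h, Represents K n c h) ↔ (K.d (n + 1) n).unop c = 0 := by
  have ex := (ShortComplex.exact_of_g_is_cokernel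
    (ShortComplex.mk _ _ (K.d_pOpcycles (n + 1) n))
    (K.opcyclesIsCokernel (n + 1) n (by simp))).unop
  have ex' := (ShortComplex.moduleCat_exact_iff _).1 ex
  constructor
  · rintro ⟨h, z, rfl, -⟩
    exact congr($(congrArg Quiver.Hom.unop (K.d_pOpcycles (n + 1) n)) z)
  · intro h
    obtain ⟨z, hz⟩ := ex' c h
    exact ⟨_, z, hz, rfl⟩

/-- Using `next n` covers degree 0 as well: there `next 0 = 0` and the differential is zero, so only
the zero cochain is a coboundary. -/
lemma Represents.eq_zero_iff {n : ℕ} {c : (K.X n).unop} {h : (K.homology n).unop}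
    (hc : Represents K n c h) :
    h = 0 ↔ ∃ g, (K.d n ((ComplexShape.down ℕ).next n)).unop g = c := by
  have ex := (ShortComplex.exact_of_f_is_kernel
    (ShortComplex.mk _ _ (K.homologyι_comp_fromOpcycles n ((ComplexShape.down ℕ).next n)))
    (K.homologyIsKernel n _ rfl)).unop
  have ex' := (ShortComplex.moduleCat_exact_iff _).1 ex
  have hinj : Function.Injective (K.pOpcycles n).unop :=
    (ModuleCat.mono_iff_injective _).1 inferInstance
  have hd (g) : (K.pOpcycles n).unop ((K.fromOpcycles n ((ComplexShape.down ℕ).next n)).unop g) =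
      (K.d n ((ComplexShape.down ℕ).next n)).unop g :=
    congr($(congrArg Quiver.Hom.unop (K.p_fromOpcycles n ((ComplexShape.down ℕ).next n))) g)
  obtain ⟨z, rfl, rfl⟩ := hc
  constructor
  · intro h
    obtain ⟨g, hg⟩ := ex' z h
    exact ⟨g, (hd g).symm.trans (congrArg _ hg)⟩
  · rintro ⟨g, hg⟩
    rw [← hd] at hg
    rw [← hinj hg]
    exact congr($(congrArg Quiver.Hom.unop
      (K.homologyι_comp_fromOpcycles n ((ComplexShape.down ℕ).next n))) g)

lemma Represents.map (φ : L ⟶ K) {n : ℕ} {c : (K.X n).unop} {h : (K.homology n).unop}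
    (hc : Represents K n c h) :
    Represents L n ((φ.f n).unop c) ((HomologicalComplex.homologyMap φ n).unop h) := by
  obtain ⟨z, rfl, rfl⟩ := hc
  refine ⟨(HomologicalComplex.opcyclesMap φ n).unop z, ?_, ?_⟩
  · exact congr($(congrArg Quiver.Hom.unop (HomologicalComplex.p_opcyclesMap φ n)) z)
  · exact congr($(congrArg Quiver.Hom.unop (HomologicalComplex.homologyι_naturality φ n)) z).symm

end OppositeComplex

/-! ### Comparing the derived-functor `Ext` with `Abelian.Ext` -/

section ExtComparison
universe v w w'

section
variable (R : Type*) [Ring R] {C : Type w} [Category.{v} C] [Abelian C] [Linear R C]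
   [EnoughProjectives C]

/-- The complex of morphisms from a complex to `Y`, as a chain complex in the opposite category. -/
noncomputable abbrev homOpComplex (K : ChainComplex C ℕ) (Y : C) :
    ChainComplex (ModuleCat.{v} R)ᵒᵖ ℕ :=
  (((linearYoneda R C).obj Y).rightOp.mapHomologicalComplex _).obj K

/-- An element of the derived functor `Ext` is represented by a cocycle on a projective
resolution. -/
def ExtRepresents {X Y : C} (P : ProjectiveResolution X) (n : ℕ) (c : P.complex.X n ⟶ Y)
    (x : ((Ext R C n).obj (op X)).obj Y) : Prop :=
  Represents (homOpComplex R P.complex Y) n c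
    ((P.isoLeftDerivedObj ((linearYoneda R C).obj Y).rightOp n).inv.unop x)

variable {R} {X Y : C} {P : ProjectiveResolution X} {n : ℕ}

lemma exists_extRepresents (x : ((Ext R C n).obj (op X)).obj Y) :
    ∃ c, ExtRepresents R P n c x :=
  exists_represents (K := homOpComplex R P.complex Y) n _

lemma exists_extRepresents_iff (c : P.complex.X n ⟶ Y) :
    (∃ x, ExtRepresents R P n c x) ↔ P.complex.d (n + 1) n ≫ c = 0 := by
  rw [← show (_ ↔ P.complex.d (n + 1) n ≫ c = 0) from
    exists_represents_iff (K := homOpComplex R P.complex Y) n c]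
  constructor
  · rintro ⟨x, hx⟩
    exact ⟨_, hx⟩
  · rintro ⟨x, hx⟩
    refine ⟨(P.isoLeftDerivedObj ((linearYoneda R C).obj Y).rightOp n).hom.unop x, ?_⟩
    exact (congrArg (Represents (homOpComplex R P.complex Y) n c)
      congr($(congrArg Quiver.Hom.unop
        (P.isoLeftDerivedObj ((linearYoneda R C).obj Y).rightOp n).inv_hom_id) x)).mpr hx

lemma ExtRepresents.eq_zero_iff {c : P.complex.X n ⟶ Y} {x : ((Ext R C n).obj (op X)).obj Y}
    (h : ExtRepresents R P n c x) :
    x = 0 ↔ ∃ g, P.complex.d n ((ComplexShape.down ℕ).next n) ≫ g = c := by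
  have hinj : Function.Injective
     (P.isoLeftDerivedObj ((linearYoneda R C).obj Y).rightOp n).inv.unop :=
    (ModuleCat.mono_iff_injective _).1 inferInstance
  exact (map_eq_zero_iff _ hinj).symm.trans (Represents.eq_zero_iff h)

lemma ExtRepresents.map {X' : C} {P' : ProjectiveResolution X'} {f : X' ⟶ X}
    (φ : ProjectiveResolution.Hom P' P f) {c : P.complex.X n ⟶ Y}
    {x : ((Ext R C n).obj (op X)).obj Y} (h : ExtRepresents R P n c x) :
    ExtRepresents R P' n (φ.hom.f n ≫ c) (((Ext R C n).map f.op).app Y x) := by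
  have := Represents.map (L := homOpComplex R P'.complex Y)
    ((((linearYoneda R C).obj Y).rightOp.mapHomologicalComplex _).map φ.hom) h
  have e := ProjectiveResolution.isoLeftDerivedObj_inv_naturality f P' P φ.hom
    (by simpa using φ.hom_f_zero_comp_π_f_zero) ((linearYoneda R C).obj Y).rightOp n
  have e' := congr($(congrArg Quiver.Hom.unop e) x)
  exact (congrArg (Represents (homOpComplex R P'.complex Y) n (φ.hom.f n ≫ c)) e').mpr this

end

section
variable {C : Type w} [Category.{v} C] [Abelian C] [HasExt.{w'} C] {X Y : C}

lemma extMk_eq_zero_iff_next (P : ProjectiveResolution X) {n : ℕ} (f : P.complex.X n ⟶ Y)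
    (hf : P.complex.d (n + 1) n ≫ f = 0) :
    P.extMk f (n + 1) rfl hf = 0 ↔
      ∃ g, P.complex.d n ((ComplexShape.down ℕ).next n) ≫ g = f := by
  cases n with
  | succ p =>
    rw [P.extMk_eq_zero_iff f _ rfl hf p rfl]
    have : (ComplexShape.down ℕ).next (p + 1) = p := by simp
    rw [this]
  | zero =>
    have h0 : P.complex.d 0 ((ComplexShape.down ℕ).next 0) = 0 := P.complex.shape _ _ (by simp)
    simp only [h0, zero_comp, exists_const]
    refine ⟨fun h => ?_, fun h => ?_⟩
    · rw [← P.extEquivCohomologyClass.apply_eq_iff_eq, P.extEquivCohomologyClass_extMk,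
        P.extEquivCohomologyClass_zero, CochainComplex.HomComplex.CohomologyClass.mk_eq_zero_iff,
        CochainComplex.HomComplex.Cocycle.toSingleMk_mem_coboundaries_iff _ _ _ _ _ 1 (by lia)] at h
      obtain ⟨g, hg⟩ := h
      -- A coboundary in degree 0 would come from cochain degree 1, where the resolution is zero.
      have : g = 0 := (P.cochainComplex.isZero_of_isStrictlyLE 0 1).eq_of_src _ _
      rw [this, comp_zero] at hg
      rw [← cancel_epi (P.cochainComplexXIso (-(0 : ℕ)) 0 rfl).hom, ← hg, comp_zero]
    · subst h; simp
end

section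
variable {R : Type*} [Ring R] {C : Type w} [Category.{v} C] [Abelian C] [Linear R C]
   [EnoughProjectives C] [HasExt.{w'} C]

/-- Lift `f` to a map of resolutions. In either model of Ext the restricted class is represented by
the same cocycle, so both vanish exactly when it is a coboundary. No natural isomorphism between the
two models is needed. -/
lemma ExtRepresents.map_eq_zero_iff {X X' Y : C} {P : ProjectiveResolution X} {n : ℕ}
    {c : P.complex.X n ⟶ Y} {x : ((Ext R C n).obj (op X)).obj Y} (h : ExtRepresents R P n c x)
    (hc : P.complex.d (n + 1) n ≫ c = 0) (f : X' ⟶ X) :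
    ((Ext R C n).map f.op).app Y x = 0 ↔
      (Abelian.Ext.mk₀ f).comp (P.extMk c (n + 1) rfl hc) (zero_add n) = 0 := by
  let P' := ProjectiveResolution.of X'
  let φ : ProjectiveResolution.Hom P' P f := ⟨ProjectiveResolution.lift f P' P,
    (ProjectiveResolution.lift_commutes_zero f P' P).trans (by simp)⟩
  rw [(h.map φ).eq_zero_iff, ProjectiveResolution.mk₀_comp_extMk (φ := φ), extMk_eq_zero_iff_next]
end
end ExtComparison

/-! ### Vanishing of local cohomology in terms of Ext classes -/

section LocalCohomology
variable {R : Type u} [CommRing R]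

/-- The canonical projection `R ⧸ J' ⟶ R ⧸ J` for `J' ≤ J`. -/
noncomputable def quotMap {J' J : Ideal R} (h : J' ≤ J) :
    ModuleCat.of R (R ⧸ J') ⟶ ModuleCat.of R (R ⧸ J) :=
  ModuleCat.ofHom (Submodule.mapQ J' J LinearMap.id h)

lemma isZero_filteredColimit_iff {J : Type} [SmallCategory J] [IsFiltered J]
    (F : J ⥤ ModuleCat.{u} R) :
    IsZero (colimit F) ↔ ∀ (j : J) (x : F.obj j), ∃ (k : J) (f : j ⟶ k), F.map f x = 0 := by
  have := preservesSmallestFilteredColimits_of_preservesFilteredColimits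
    (forget (ModuleCat.{u} R))
  rw [ModuleCat.isZero_iff_subsingleton]
  constructor
  · intro h j x
    exact Concrete.colimit_rep_eq_zero (R := R) F j x (Subsingleton.elim _ _)
  · intro h
    refine subsingleton_of_forall_eq 0 fun y => ?_
    obtain ⟨j, x, rfl⟩ := Concrete.colimit_exists_rep F y
    obtain ⟨k, f, hf⟩ := h j x
    rw [← colimit.w F f, ModuleCat.comp_apply, hf, map_zero]

lemma isZero_localCohomology_iff (a : Ideal R) (N : ModuleCat.{u} R) (i : ℕ) :
    IsZero ((localCohomology a i).obj N) ↔
      ∀ (t : ℕ) (x : Abelian.Ext.{u} (ModuleCat.of R (R ⧸ a ^ t)) N i), ∃ (s : ℕ) (h : t ≤ s),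
        (Abelian.Ext.mk₀ (quotMap (Ideal.pow_le_pow_right h))).comp x (zero_add i) = 0 := by
  let F := localCohomology.diagram (localCohomology.idealPowersDiagram a) i ⋙
    (evaluation (ModuleCat.{u} R) (ModuleCat.{u} R)).obj N
  have e : (localCohomology a i).obj N ≅ colimit F :=
    colimitObjIsoColimitCompEvaluation _ N
  rw [e.isZero_iff, isZero_filteredColimit_iff]
  have key (t s : ℕ) (h : t ≤ s) (P : ProjectiveResolution (ModuleCat.of R (R ⧸ a ^ t)))
      (c : P.complex.X i ⟶ N) (x : ((Ext R _ i).obj (op (ModuleCat.of R (R ⧸ a ^ t)))).obj N)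
      (hc : P.complex.d (i + 1) i ≫ c = 0) (hx : ExtRepresents R P i c x)
      (f : op (op t) ⟶ op (op s)) :
      F.map f x = 0 ↔ (Abelian.Ext.mk₀ (quotMap (Ideal.pow_le_pow_right h))).comp
        (P.extMk c (i + 1) rfl hc) (zero_add i) = 0 :=
    hx.map_eq_zero_iff hc _
  constructor
  · intro H t x
    let P := ProjectiveResolution.of (ModuleCat.of R (R ⧸ a ^ t))
    obtain ⟨c, hc, rfl⟩ := P.extMk_surjective x (i + 1) rfl
    obtain ⟨y, hy⟩ := (exists_extRepresents_iff (R := R) c).2 hc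
    obtain ⟨k, f, hf⟩ := H (op (op t)) y
    exact ⟨k.unop.unop, f.unop.unop.le, (key t _ f.unop.unop.le P c y hc hy f).1 hf⟩
  · intro H j y
    let P := ProjectiveResolution.of (ModuleCat.of R (R ⧸ a ^ j.unop.unop))
    obtain ⟨c, hy⟩ := exists_extRepresents (R := R) (P := P) y
    have hc := (exists_extRepresents_iff (R := R) c).1 ⟨y, hy⟩
    obtain ⟨s, h, hs⟩ := H _ (P.extMk c (i + 1) rfl hc)
    exact ⟨op (op s), (homOfLE h).op.op, (key _ _ h P c y hc hy _).2 hs⟩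

end LocalCohomology

open Abelian

/-! ### Vanishing in the colimit and long exact sequences -/

section ExtColim
variable {R : Type u} [CommRing R]

lemma quotMap_comp {J'' J' J : Ideal R} (h' : J'' ≤ J') (h : J' ≤ J) :
    quotMap h' ≫ quotMap h = quotMap (h'.trans h) := by
  refine ModuleCat.hom_ext (LinearMap.ext fun x => ?_)
  obtain ⟨x, rfl⟩ := Submodule.Quotient.mk_surjective _ x
  rfl

lemma shortExact_of_exact {A B C : Type u} [AddCommGroup A] [AddCommGroup B] [AddCommGroup C]
    [Module R A] [Module R B] [Module R C] {f : A →ₗ[R] B} {g : B →ₗ[R] C}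
    (hf : Function.Injective f) (hfg : Function.Exact f g) (hg : Function.Surjective g) :
    (ModuleCat.shortComplexOfCompEqZero f g hfg.linearMap_comp_eq_zero).ShortExact :=
  ModuleCat.shortComplex_shortExact _ hfg hf hg

/-- Restriction of `Ext` along the projection `R ⧸ J' ⟶ R ⧸ J`. -/
noncomputable def extRes {J' J : Ideal R} (h : J' ≤ J) {N : ModuleCat.{u} R} {i : ℕ}
    (x : Ext.{u} (ModuleCat.of R (R ⧸ J)) N i) : Ext.{u} (ModuleCat.of R (R ⧸ J')) N i :=
  (Ext.mk₀ (quotMap h)).comp x (zero_add i)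

@[simp]
lemma extRes_zero {J' J : Ideal R} (h : J' ≤ J) {N : ModuleCat.{u} R} {i : ℕ} :
    extRes h (0 : Ext.{u} (ModuleCat.of R (R ⧸ J)) N i) = 0 := by
  simp [extRes]

lemma extRes_extRes {J'' J' J : Ideal R} (h' : J'' ≤ J') (h : J' ≤ J) {N : ModuleCat.{u} R}
    {i : ℕ} (x : Ext.{u} (ModuleCat.of R (R ⧸ J)) N i) :
    extRes h' (extRes h x) = extRes (h'.trans h) x := by
  simp [extRes, quotMap_comp]

lemma extRes_comp {J' J : Ideal R} (h : J' ≤ J) {N N' : ModuleCat.{u} R}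
    {i j k : ℕ} (x : Ext.{u} (ModuleCat.of R (R ⧸ J)) N i) (y : Ext.{u} N N' j)
    (hk : i + j = k) :
    (extRes h x).comp y hk = extRes h (x.comp y hk) := by
  unfold extRes
  rw [Ext.comp_assoc _ _ _ _ _ (by lia)]

/-- Every class in `Ext i (R ⧸ J) N`, with `J` containing a power of `a`, dies in
`Ext i (R ⧸ J') N` for some smaller `J'` of the same kind. -/
def ExtColimVanishes (a : Ideal R) (i : ℕ) (N : ModuleCat.{u} R) : Prop :=
  ∀ (J : Ideal R) (_ : a ≤ J.radical) (x : Ext.{u} (ModuleCat.of R (R ⧸ J)) N i),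
    ∃ (J' : Ideal R) (h : J' ≤ J), a ≤ J'.radical ∧ extRes h x = 0

lemma le_radical_pow (a : Ideal R) (t : ℕ) : a ≤ (a ^ t).radical :=
  fun _ hr => ⟨t, Ideal.pow_mem_pow hr t⟩

/-- Powers of `a` are cofinal among the ideals whose radical contains `a`, because `a` is finitely
generated. -/
lemma extColimVanishes_iff_isZero [IsNoetherianRing R] {a : Ideal R} {i : ℕ}
    {N : ModuleCat.{u} R} :
    ExtColimVanishes a i N ↔ IsZero ((localCohomology a i).obj N) := by
  rw [isZero_localCohomology_iff]
  constructor
  · intro H t x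
    obtain ⟨J', h, hJ', hx⟩ := H _ (le_radical_pow a t) x
    obtain ⟨s, hs⟩ := Ideal.exists_pow_le_of_le_radical_of_fg hJ' (IsNoetherian.noetherian a)
    have hs' : a ^ (s + t) ≤ J' := (Ideal.pow_le_pow_right (by lia)).trans hs
    refine ⟨s + t, by lia, ?_⟩
    rw [← extRes, ← extRes_extRes hs' h, hx, extRes_zero]
  · intro H J hJ x
    obtain ⟨t, ht⟩ := Ideal.exists_pow_le_of_le_radical_of_fg hJ (IsNoetherian.noetherian a)
    obtain ⟨s, hs, hx⟩ := H t (extRes ht x)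
    rw [← extRes, extRes_extRes] at hx
    exact ⟨_, _, le_radical_pow a s, hx⟩

variable {a : Ideal R} {i : ℕ}

lemma ExtColimVanishes.of_iso {N N' : ModuleCat.{u} R} (e : N ≅ N')
    (h : ExtColimVanishes a i N) : ExtColimVanishes a i N' := by
  intro J hJ x
  obtain ⟨J', hle, hJ', hx⟩ := h J hJ (x.comp (Ext.mk₀ e.inv) (add_zero i))
  refine ⟨J', hle, hJ', ?_⟩
  have : x = (x.comp (Ext.mk₀ e.inv) (add_zero i)).comp (Ext.mk₀ e.hom) (add_zero i) := by
    rw [Ext.comp_assoc_of_third_deg_zero, Ext.mk₀_comp_mk₀, e.inv_hom_id, Ext.comp_mk₀_id]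
  rw [this, ← extRes_comp, hx, Ext.zero_comp]

lemma extColimVanishes_of_isZero {N : ModuleCat.{u} R} (h : IsZero N) :
    ExtColimVanishes a i N := by
  intro J hJ x
  refine ⟨J, le_rfl, hJ, ?_⟩
  rw [show x = 0 from ?_, extRes_zero]
  rw [← Ext.comp_mk₀_id x, h.eq_of_src (𝟙 N) 0, Ext.mk₀_zero, Ext.comp_zero]

section ShortExact
variable {S : ShortComplex (ModuleCat.{u} R)} (hS : S.ShortExact)
include hS

/-- Exactness survives the filtered colimit: shrink `J` once to kill the image of the class, lift it
by the exact sequence at that level, and shrink again to kill the lift. `right` and `left` follow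
the same pattern. -/
lemma ExtColimVanishes.middle (h₁ : ExtColimVanishes a i S.X₁) (h₃ : ExtColimVanishes a i S.X₃) :
    ExtColimVanishes a i S.X₂ := by
  intro J hJ x
  obtain ⟨J', hle, hJ', hx⟩ := h₃ J hJ (x.comp (Ext.mk₀ S.g) (add_zero i))
  rw [← extRes_comp] at hx
  obtain ⟨y, hy⟩ := Ext.covariant_sequence_exact₂ _ hS _ hx
  obtain ⟨J'', hle', hJ'', hy'⟩ := h₁ J' hJ' y
  refine ⟨J'', hle'.trans hle, hJ'', ?_⟩
  rw [← extRes_extRes hle' hle, ← hy, ← extRes_comp, hy', Ext.zero_comp]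

lemma ExtColimVanishes.right (h₂ : ExtColimVanishes a i S.X₂)
    (h₁ : ExtColimVanishes a (i + 1) S.X₁) : ExtColimVanishes a i S.X₃ := by
  intro J hJ x
  obtain ⟨J', hle, hJ', hx⟩ := h₁ J hJ (x.comp hS.extClass rfl)
  rw [← extRes_comp] at hx
  obtain ⟨y, hy⟩ := Ext.covariant_sequence_exact₃ _ hS _ _ hx
  obtain ⟨J'', hle', hJ'', hy'⟩ := h₂ J' hJ' y
  refine ⟨J'', hle'.trans hle, hJ'', ?_⟩
  rw [← extRes_extRes hle' hle, ← hy, ← extRes_comp, hy', Ext.zero_comp]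

lemma ExtColimVanishes.left (h₃ : ExtColimVanishes a i S.X₃)
    (h₂ : ExtColimVanishes a (i + 1) S.X₂) : ExtColimVanishes a (i + 1) S.X₁ := by
  intro J hJ x
  obtain ⟨J', hle, hJ', hx⟩ := h₂ J hJ (x.comp (Ext.mk₀ S.f) (add_zero _))
  rw [← extRes_comp] at hx
  obtain ⟨y, hy⟩ := Ext.covariant_sequence_exact₁ _ hS _ hx rfl
  obtain ⟨J'', hle', hJ'', hy'⟩ := h₃ J' hJ' y
  refine ⟨J'', hle'.trans hle, hJ'', ?_⟩
  rw [← extRes_extRes hle' hle, ← hy, ← extRes_comp, hy', Ext.zero_comp]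

lemma ExtColimVanishes.left_zero (h₂ : ExtColimVanishes a 0 S.X₂) :
    ExtColimVanishes a 0 S.X₁ := by
  intro J hJ x
  obtain ⟨J', hle, hJ', hx⟩ := h₂ J hJ (x.comp (Ext.mk₀ S.f) (add_zero _))
  refine ⟨J', hle, hJ', ?_⟩
  rw [← extRes_comp] at hx
  have := hS.mono_f
  exact Ext.postcomp_mk₀_injective_of_mono _ S.f (hx.trans (by simp))

end ShortExact

/-- An element killed by `a` is a map $R/\mathfrak a\to N$. Restriction to a deeper quotient keeps
the image of 1, so the map can die only if the element is zero. -/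
lemma ExtColimVanishes.eq_zero_of_smul_eq_zero {N : Type u} [AddCommGroup N] [Module R N]
    (h : ExtColimVanishes a 0 (ModuleCat.of R N)) {n : N} (hn : ∀ r ∈ a, r • n = 0) : n = 0 := by
  let f : ModuleCat.of R (R ⧸ a) ⟶ ModuleCat.of R N :=
    ModuleCat.ofHom (Submodule.liftQ a (LinearMap.toSpanSingleton R N n) fun r hr => hn r hr)
  obtain ⟨J', hle, hJ', hx⟩ := h a Ideal.le_radical (Ext.mk₀ f)
  rw [extRes, Ext.mk₀_comp_mk₀, Ext.mk₀_eq_zero_iff] at hx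
  have := congr($hx (Submodule.Quotient.mk 1))
  have h1 : f (Submodule.Quotient.mk 1) = n := one_smul R n
  exact h1.symm.trans this

lemma ExtColimVanishes.pi (h : ExtColimVanishes a i (ModuleCat.of R R)) (n : ℕ) :
    ExtColimVanishes a i (ModuleCat.of R (Fin n → R)) := by
  induction n with
  | zero => exact extColimVanishes_of_isZero (ModuleCat.isZero_of_subsingleton _)
  | succ n ih =>
    refine ExtColimVanishes.middle (shortExact_of_exact
      (f := LinearMap.single R (fun _ : Fin (n + 1) => R) 0)
      (g := LinearMap.funLeft R R Fin.succ) (Pi.single_injective (M := fun _ : Fin (n + 1) => R) 0)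
      (fun v => ?_)
      (LinearMap.funLeft_surjective_of_injective _ _ _ (Fin.succ_injective n))) h ih
    constructor
    · intro hv
      refine ⟨v 0, funext fun j => ?_⟩
      refine Fin.cases (by simp) (fun j => ?_) j
      simpa using (congrFun hv j).symm
    · rintro ⟨r, rfl⟩
      ext j
      simp [LinearMap.funLeft_apply]

lemma ExtColimVanishes.free (h : ExtColimVanishes a i (ModuleCat.of R R)) (F : Type u)
    [AddCommGroup F] [Module R F] [Module.Free R F] [Module.Finite R F] :
    ExtColimVanishes a i (ModuleCat.of R F) :=
  (h.pi _).of_iso (((Module.Free.chooseBasis R F).reindex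
    (Fintype.equivFin _)).equivFun.symm.toModuleIso)

end ExtColim

/-! ### Vanishing above the number of generators -/

section Bound
variable {R : Type u} [CommRing R]

lemma exists_comp_eq_of_ker_le {A B C : Type*} [AddCommGroup A] [AddCommGroup B] [AddCommGroup C]
    [Module R A] [Module R B] [Module R C] {f : A →ₗ[R] B} (hf : Function.Surjective f)
    {g : A →ₗ[R] C} (h : LinearMap.ker f ≤ LinearMap.ker g) : ∃ l : B →ₗ[R] C, l ∘ₗ f = g := by
  refine ⟨(LinearMap.ker f).liftQ g h ∘ₗ (f.quotKerEquivOfSurjective hf).symm.toLinearMap, ?_⟩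
  ext x
  have : (f.quotKerEquivOfSurjective hf).symm (f x) = Submodule.Quotient.mk x := by
    rw [LinearEquiv.symm_apply_eq]
    rfl
  simp [this]

/-- The `Ext` groups of the quotients `R ⧸ J t` become zero in the colimit over `t`, in degrees
greater than `r`. -/
def ExtColimVanishesAbove (J : ℕ → Ideal R) (r : ℕ) : Prop :=
  ∀ (i : ℕ) (_ : r < i) (N : ModuleCat.{u} R) (t : ℕ)
    (x : Ext.{u} (ModuleCat.of R (R ⧸ J t)) N i),
    ∃ (s : ℕ) (_ : t ≤ s) (h : J s ≤ J t), extRes h x = 0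

lemma extColimVanishesAbove_bot : ExtColimVanishesAbove (fun _ => (⊥ : Ideal R)) 0 := by
  intro i hi N t x
  obtain ⟨i, rfl⟩ := Nat.exists_eq_add_one_of_ne_zero hi.ne'
  have : Module.Projective R (R ⧸ (⊥ : Ideal R)) :=
    Module.Projective.of_equiv (Submodule.quotEquivOfEqBot (⊥ : Ideal R) rfl).symm
  have : Projective (ModuleCat.of R (R ⧸ (⊥ : Ideal R))) :=
    (IsProjective.iff_projective _).1 this
  exact ⟨t, le_rfl, le_rfl, Ext.eq_zero_of_projective _⟩

/-- For `w` large, powers of `x` satisfy `(J : x ^ w) ≤ (J : x ^ (w - s))`. -/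
lemma exists_colon_stable [IsNoetherianRing R] (J : Ideal R) (x : R) (s : ℕ) (m : ℕ) :
    ∃ w, s ≤ w ∧ m ≤ w ∧ ∀ y, x ^ w * y ∈ J → x ^ (w - s) * y ∈ J := by
  let c : ℕ →o Ideal R :=
    { toFun n := Submodule.comap (LinearMap.mulLeft R (x ^ n)) J
      monotone' n k hnk y hy := by
        obtain ⟨d, rfl⟩ := Nat.exists_eq_add_of_le' hnk
        simp only [Submodule.mem_comap, LinearMap.mulLeft_apply] at hy ⊢
        rw [pow_add, mul_assoc]
        exact J.mul_mem_left _ hy }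
  obtain ⟨n, hn⟩ := monotone_stabilizes_iff_noetherian.2 (inferInstance : IsNoetherian R R) c
  -- Both `w` and `w - s` lie past the stabilization index `n`, so their colon ideals coincide.
  refine ⟨n + s + m, by lia, by lia, fun y hy => ?_⟩
  have h1 := hn (n + s + m) (by lia)
  have h2 := hn (n + s + m - s) (by lia)
  have : y ∈ c (n + s + m - s) := by
    rw [← h2, h1]
    exact hy
  exact this

variable (J : ℕ → Ideal R) (x : R)

/-- The kernel of `R ⧸ J t → R ⧸ (J t ⊔ (x ^ t))`. -/
noncomputable abbrev powKer (t : ℕ) : Submodule R (R ⧸ J t) :=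
  LinearMap.ker (quotMap (le_sup_left : J t ≤ J t ⊔ Ideal.span {x ^ t})).hom

lemma quotMap_surjective {J' J : Ideal R} (h : J' ≤ J) : Function.Surjective (quotMap h) := by
  intro y
  obtain ⟨y, rfl⟩ := Submodule.Quotient.mk_surjective _ y
  exact ⟨Submodule.Quotient.mk y, rfl⟩

lemma quotMap_mk {J' J : Ideal R} (h : J' ≤ J) (y : R) :
    (quotMap h).hom (Submodule.Quotient.mk y) = Submodule.Quotient.mk y := rfl

/-- Multiplication by `x ^ t` as a map onto the kernel of `R ⧸ J t → R ⧸ (J t ⊔ (x ^ t))`. -/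
noncomputable def toPowKer (t : ℕ) : (R ⧸ J t) →ₗ[R] powKer J x t :=
  LinearMap.codRestrict _ (LinearMap.lsmul R _ (x ^ t)) fun y => by
    obtain ⟨y, rfl⟩ := Submodule.Quotient.mk_surjective _ y
    rw [LinearMap.mem_ker, LinearMap.lsmul_apply, ← Submodule.Quotient.mk_smul, quotMap_mk]
    refine (Submodule.Quotient.mk_eq_zero _).2 (Ideal.mem_sup_right ?_)
    exact Ideal.mul_mem_right _ _ (Ideal.mem_span_singleton_self _)

lemma coe_toPowKer_mk (t : ℕ) (y : R) :
    (toPowKer J x t (Submodule.Quotient.mk y) : R ⧸ J t) = Submodule.Quotient.mk (x ^ t * y) := rfl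

lemma toPowKer_surjective (t : ℕ) : Function.Surjective (toPowKer J x t) := by
  rintro ⟨z, hz⟩
  obtain ⟨z, rfl⟩ := Submodule.Quotient.mk_surjective _ z
  have hz' : z ∈ J t ⊔ Ideal.span {x ^ t} := (Submodule.Quotient.mk_eq_zero _).1 hz
  obtain ⟨j, hj, y, hy, rfl⟩ := Submodule.mem_sup.1 hz'
  obtain ⟨y, rfl⟩ := Ideal.mem_span_singleton.1 hy
  refine ⟨Submodule.Quotient.mk y, Subtype.ext ?_⟩
  rw [coe_toPowKer_mk]
  refine (Submodule.Quotient.eq _).2 ?_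
  simpa using hj

variable {J x}

/-- The map induced on `powKer` by the projections. -/
noncomputable def powKerMap {t s : ℕ} (h : J s ≤ J t)
    (h' : J s ⊔ Ideal.span {x ^ s} ≤ J t ⊔ Ideal.span {x ^ t}) :
    powKer J x s →ₗ[R] powKer J x t :=
  LinearMap.restrict (quotMap h).hom fun z hz => by
    have e := congr($((quotMap_comp h le_sup_left).trans (quotMap_comp le_sup_left h').symm) z)
    refine LinearMap.mem_ker.2 (e.trans ?_)
    exact (congrArg (quotMap h') (LinearMap.mem_ker.1 hz)).trans (map_zero (quotMap h').hom)

variable (J x) in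
lemma powKer_shortExact (t : ℕ) :
    (ModuleCat.shortComplexOfCompEqZero (powKer J x t).subtype
      (quotMap (le_sup_left : J t ≤ J t ⊔ Ideal.span {x ^ t})).hom
      (LinearMap.exact_subtype_ker_map _).linearMap_comp_eq_zero).ShortExact :=
  shortExact_of_exact (Submodule.injective_subtype _) (LinearMap.exact_subtype_ker_map _)
    (quotMap_surjective _)

lemma extRes_extClass_comp {t s : ℕ} (h : J s ≤ J t)
    (h' : J s ⊔ Ideal.span {x ^ s} ≤ J t ⊔ Ideal.span {x ^ t}) {N : ModuleCat.{u} R} {i j : ℕ}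
    (y : Ext.{u} (ModuleCat.of R (powKer J x t)) N i) (hj : 1 + i = j) :
    extRes h' ((powKer_shortExact J x t).extClass.comp y hj) =
      (powKer_shortExact J x s).extClass.comp
        ((Ext.mk₀ (ModuleCat.ofHom (powKerMap h h'))).comp y (zero_add i)) hj := by
  let φ : ModuleCat.shortComplexOfCompEqZero (powKer J x s).subtype
      (quotMap (le_sup_left : J s ≤ J s ⊔ Ideal.span {x ^ s})).hom
      (LinearMap.exact_subtype_ker_map _).linearMap_comp_eq_zero ⟶
      ModuleCat.shortComplexOfCompEqZero (powKer J x t).subtype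
      (quotMap (le_sup_left : J t ≤ J t ⊔ Ideal.span {x ^ t})).hom
      (LinearMap.exact_subtype_ker_map _).linearMap_comp_eq_zero :=
    { τ₁ := ModuleCat.ofHom (powKerMap h h')
      τ₂ := quotMap h
      τ₃ := quotMap h'
      comm₁₂ := rfl
      comm₂₃ := (quotMap_comp h le_sup_left).trans (quotMap_comp le_sup_left h').symm }
  have := ShortComplex.ShortExact.extClass_naturality
    (powKer_shortExact J x s) (powKer_shortExact J x t) φ
  unfold extRes
  rw [← Ext.comp_assoc _ _ _ (zero_add 1) hj (by lia)]
  rw [← Ext.comp_assoc _ _ _ (add_zero 1) (zero_add i) (by lia)]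
  exact congrArg (fun z => Ext.comp z y hj) this.symm

/-- Adjoining powers of one element costs one degree. A class that dies on $R/J_s$ comes from a
class `η` on the kernel $x^s(R/J_s)$, one degree lower. The pullback of `η` to $R/J_s$ dies on some
$R/J_{s'}$, and for large `w` the transition map of kernels from `w` to `s` factors through
$R/J_{s'}$. -/
lemma ExtColimVanishesAbove.sup_span_pow [IsNoetherianRing R] (hJ : Antitone J) {r : ℕ}
    (h : ExtColimVanishesAbove J r) (x : R) :
    ExtColimVanishesAbove (fun t => J t ⊔ Ideal.span {x ^ t}) (r + 1) := by
  intro i hi N u ξ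
  have hle {t s : ℕ} (hts : t ≤ s) :
      J s ⊔ Ideal.span {x ^ s} ≤ J t ⊔ Ideal.span {x ^ t} := by
    refine sup_le_sup (hJ hts) ?_
    rw [Ideal.span_singleton_le_span_singleton]
    exact pow_dvd_pow x hts
  obtain ⟨i, rfl⟩ := Nat.exists_eq_add_of_lt (Nat.zero_lt_of_lt hi)
  obtain ⟨s, hus, hs, h0⟩ := h _ (by lia) N u (extRes le_sup_left ξ)
  obtain ⟨η, hη⟩ := Ext.contravariant_sequence_exact₃ (powKer_shortExact J x s) N
    (extRes (hle hus) ξ) (by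
      refine Eq.trans ?_ h0
      rw [extRes_extRes]
      exact extRes_extRes (le_sup_left : J s ≤ J s ⊔ Ideal.span {x ^ s}) (hle hus) ξ)
    (n₀ := i) (by lia)
  obtain ⟨s', hs', hle', h1⟩ := h i (by lia) N s
    ((Ext.mk₀ (ModuleCat.ofHom (toPowKer J x s))).comp η (zero_add i))
  obtain ⟨w, hsw, hs'w, hw⟩ := exists_colon_stable (J s') x s s'
  -- The map `l` sends $x^wy$ to $x^{w-s}y$ modulo $J_{s'}$; the choice of `w` by colon stability
  -- makes it well defined.
  obtain ⟨l, hl⟩ := exists_comp_eq_of_ker_le (toPowKer_surjective J x w)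
    (g := LinearMap.lsmul R _ (x ^ (w - s)) ∘ₗ (quotMap (hJ hs'w)).hom) (by
      intro z hz
      obtain ⟨z, rfl⟩ := Submodule.Quotient.mk_surjective _ z
      have hz' : x ^ w * z ∈ J w :=
        (Submodule.Quotient.mk_eq_zero _).1 (congrArg Subtype.val (LinearMap.mem_ker.1 hz))
      exact (Submodule.Quotient.mk_eq_zero _).2 (hw z (hJ hs'w hz')))
  have hfac : ModuleCat.ofHom (powKerMap (hJ hsw) (hle hsw)) =
      ModuleCat.ofHom l ≫ quotMap hle' ≫ ModuleCat.ofHom (toPowKer J x s) := by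
    have : powKerMap (hJ hsw) (hle hsw) = (toPowKer J x s ∘ₗ (quotMap hle').hom) ∘ₗ l := by
      rw [← LinearMap.cancel_right (toPowKer_surjective J x w), LinearMap.comp_assoc, hl]
      refine LinearMap.ext fun z => Subtype.ext ?_
      obtain ⟨z, rfl⟩ := Submodule.Quotient.mk_surjective _ z
      change Submodule.Quotient.mk (x ^ w * z) =
        Submodule.Quotient.mk (x ^ s * (x ^ (w - s) * z))
      rw [← mul_assoc, ← pow_add, Nat.add_sub_cancel' hsw]
    rw [this]
    rfl
  refine ⟨w, hus.trans hsw, hle (hus.trans hsw), ?_⟩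
  rw [← extRes_extRes (hle hsw) (hle hus), ← hη]
  refine (extRes_extClass_comp (hJ hsw) (hle hsw) η (by lia)).trans ?_
  rw [hfac, ← Ext.mk₀_comp_mk₀_assoc, ← Ext.mk₀_comp_mk₀_assoc]
  unfold extRes at h1
  rw [h1, Ext.comp_zero, Ext.comp_zero]

/-- The ideal `J t` is generated by the `t`-th powers of the elements of `S`, adjoined one at a
time. The last two clauses make this family cofinal with the powers of the ideal. -/
lemma exists_extColimVanishesAbove_span [IsNoetherianRing R] (S : Finset R) :
    ∃ J : ℕ → Ideal R, Antitone J ∧ ExtColimVanishesAbove J S.card ∧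
      (∀ t, J t ≤ Ideal.span S ^ t) ∧ ∀ t, Ideal.span S ≤ (J t).radical := by
  classical
  induction S using Finset.induction_on with
  | empty => exact ⟨fun _ => ⊥, fun _ _ _ => le_rfl, extColimVanishesAbove_bot, by simp, by simp⟩
  | insert x S hx ih =>
    obtain ⟨J, hJ, hv, h1, h2⟩ := ih
    have hS : Ideal.span (S : Set R) ≤ Ideal.span (insert x S : Finset R) :=
      Ideal.span_mono (by simp)
    refine ⟨fun t => J t ⊔ Ideal.span {x ^ t}, fun t s hts => sup_le_sup (hJ hts) ?_, ?_,
      fun t => sup_le ((h1 t).trans (Ideal.pow_right_mono hS t)) ?_, fun t => ?_⟩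
    · rw [Ideal.span_singleton_le_span_singleton]
      exact pow_dvd_pow x hts
    · rw [Finset.card_insert_of_notMem hx]
      exact hv.sup_span_pow hJ x
    · rw [Ideal.span_singleton_le_iff_mem]
      exact Ideal.pow_mem_pow (Ideal.subset_span (by simp)) t
    · rw [Ideal.span_le, Finset.coe_insert, Set.insert_subset_iff]
      refine ⟨⟨t, Ideal.mem_sup_right (Ideal.mem_span_singleton_self _)⟩, ?_⟩
      exact (Ideal.subset_span).trans ((h2 t).trans (Ideal.radical_mono le_sup_left))

/-- Local cohomology vanishes above the number of generators, uniformly in the module. -/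
lemma exists_extColimVanishes_of_lt [IsNoetherianRing R] (a : Ideal R) :
    ∃ r, ∀ i, r < i → ∀ N : ModuleCat.{u} R, ExtColimVanishes a i N := by
  obtain ⟨S, rfl⟩ := IsNoetherian.noetherian a
  obtain ⟨J, hJ, hv, h1, h2⟩ := exists_extColimVanishesAbove_span S
  refine ⟨S.card, fun i hi N I hI x => ?_⟩
  obtain ⟨t, ht⟩ := Ideal.exists_pow_le_of_le_radical_of_fg hI (IsNoetherian.noetherian _)
  obtain ⟨s, -, hs, hx⟩ := hv i hi N t (extRes ((h1 t).trans ht) x)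
  rw [extRes_extRes] at hx
  exact ⟨_, _, h2 s, hx⟩

end Bound
end RelativeCM

namespace RelativeCM

open CategoryTheory CategoryTheory.Limits Abelian

/-! ### Existence of a nonvanishing degree and descent from the ring to modules -/

section Nonvanishing
variable {R : Type u} [CommRing R] [IsNoetherianRing R] {a : Ideal R}

/-- Prime avoidance: if `a` consisted of zero divisors, it would lie in a single associated prime,
hence annihilate a nonzero element. -/
lemma exists_mem_isSMulRegular {N : Type*} [AddCommGroup N] [Module R N] [Module.Finite R N]
    (h : ∀ n : N, (∀ r ∈ a, r • n = 0) → n = 0) : ∃ x ∈ a, IsSMulRegular N x := by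
  by_contra! H
  obtain ⟨P, hP, haP⟩ := (a.subset_union_prime_finite (associatedPrimes.finite R N) (f := id) 0 0
    fun _ h _ _ ↦ h.isPrime).1 (by
      simp_rw [id, biUnion_associatedPrimes_eq_zero_divisors]
      intro x hx
      by_contra hx'
      refine H x hx (isSMulRegular_iff_right_eq_zero_of_smul.2 fun n hn => ?_)
      by_contra hn'
      exact hx' ⟨n, hn', hn⟩)
  rw [AssociatedPrimes.mem_iff, isAssociatedPrime_iff] at hP
  obtain ⟨hprime, n, rfl⟩ := hP
  refine hprime.ne_top ?_
  rw [h n fun r hr => by simpa [Submodule.mem_colon_singleton] using haP hr]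
  simp

/-- Noetherian induction on `L`. If every degree vanished, degree 0 would give $x\in\mathfrak a$
regular on $N/L$, and multiplication by $x$ would pass the vanishing on to $N/(L+xN)$. Since
$xN\subseteq\mathfrak aN$, the hypothesis persists for the larger submodule. -/
lemma exists_not_extColimVanishes_quotient {N : Type u} [AddCommGroup N] [Module R N]
    [Module.Finite R N] (L : Submodule R N) (hL : a • ⊤ ⊔ L ≠ ⊤) :
    ∃ i, ¬ ExtColimVanishes a i (ModuleCat.of R (N ⧸ L)) := by
  induction L using WellFoundedGT.induction with
  | ind L ih =>
  by_contra! H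
  obtain ⟨x, hxa, hx⟩ := exists_mem_isSMulRegular fun n => (H 0).eq_zero_of_smul_eq_zero (n := n)
  let f : (N ⧸ L) →ₗ[R] (N ⧸ L) := LinearMap.lsmul R _ x
  have hf : Function.Injective f := hx
  let L' : Submodule R N := (LinearMap.range f).comap L.mkQ
  have hmem (n : N) : n ∈ L' ↔ ∃ m : N, L.mkQ (x • m) = L.mkQ n := by
    constructor
    · rintro ⟨m, hm⟩
      obtain ⟨m, rfl⟩ := Submodule.Quotient.mk_surjective _ m
      exact ⟨m, hm⟩
    · rintro ⟨m, hm⟩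
      exact ⟨L.mkQ m, hm⟩
  have hle : L ≤ L' := fun n hn => (hmem n).2 ⟨0, by
    rw [smul_zero, map_zero, eq_comm]
    exact (Submodule.Quotient.mk_eq_zero _).2 hn⟩
  -- Equality would mean that `x` is both zero and injective on `N ⧸ L`, forcing `L = ⊤`.
  have hlt : L < L' := by
    refine lt_of_le_of_ne hle fun heq => hL ?_
    suffices L = ⊤ by rw [this, sup_top_eq]
    refine eq_top_iff.2 fun n _ => ?_
    have h1 : x • n ∈ L := by
      rw [heq]
      exact (hmem _).2 ⟨n, rfl⟩
    refine (Submodule.Quotient.mk_eq_zero _).1 (hf (a₂ := 0) ?_)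
    rw [map_zero]
    exact (Submodule.Quotient.mk_eq_zero _).2 h1
  have hsup : a • ⊤ ⊔ L' ≠ ⊤ := by
    refine fun h => hL (eq_top_iff.2 (h.symm.le.trans (sup_le le_sup_left fun n hn => ?_)))
    obtain ⟨m, hm⟩ := (hmem n).1 hn
    have h1 : n - x • m ∈ L := (Submodule.Quotient.eq _).1 hm.symm
    rw [← add_sub_cancel (x • m) n]
    exact Submodule.add_mem_sup (Submodule.smul_mem_smul hxa trivial) h1
  obtain ⟨i, hi⟩ := ih L' hlt hsup
  refine hi (ExtColimVanishes.right (shortExact_of_exact hf (g := Submodule.factor hle)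
    (fun n => ?_) (Submodule.factor_surjective hle)) (H i) (H (i + 1)))
  obtain ⟨n, rfl⟩ := Submodule.Quotient.mk_surjective _ n
  exact Submodule.Quotient.mk_eq_zero _

lemma exists_not_extColimVanishes {N : Type u} [AddCommGroup N] [Module R N]
    [Module.Finite R N] (h : a • (⊤ : Submodule R N) ≠ ⊤) :
    ∃ i, ¬ ExtColimVanishes a i (ModuleCat.of R N) := by
  obtain ⟨i, hi⟩ := exists_not_extColimVanishes_quotient (a := a) (⊥ : Submodule R N) (by simpa)
  exact ⟨i, fun H => hi (H.of_iso (Submodule.quotEquivOfEqBot _ rfl).symm.toModuleIso)⟩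

/-- Descending induction from the uniform bound `r`: with $0\to K\to R^n\to N\to0$, vanishing for
$R^n$ in degree $i$ and for $K$ in degree $i+1$ gives it for $N$ in degree $i$. -/
lemma extColimVanishes_of_forall_gt {d : ℕ}
    (hd : ∀ i, d < i → ExtColimVanishes a i (ModuleCat.of R R)) {i : ℕ} (hi : d < i)
    (N : Type u) [AddCommGroup N] [Module R N] [Module.Finite R N] :
    ExtColimVanishes a i (ModuleCat.of R N) := by
  obtain ⟨r, hr⟩ := exists_extColimVanishes_of_lt a
  obtain ⟨k, hk⟩ : ∃ k, r < i + k := ⟨r + 1, by lia⟩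
  induction k generalizing i N with
  | zero => exact hr i hk _
  | succ k ih =>
    obtain ⟨n, f, hf⟩ := Module.Finite.exists_fin' R N
    exact ExtColimVanishes.right (shortExact_of_exact (LinearMap.ker f).injective_subtype
      (LinearMap.exact_subtype_ker_map f) hf) ((hd i hi).pi n)
      (ih (hi.trans (Nat.lt_succ_self i)) (LinearMap.ker f) (by lia))

end Nonvanishing

/-! ### Grade and relative Cohen–Macaulayness of syzygies -/

section Syzygy
variable {R : Type u} [CommRing R]

namespace FiniteFreeResolution
variable {M : Type u} [AddCommGroup M] [Module R M] (P : FiniteFreeResolution R M)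

lemma exists_shortExact (n : ℕ) :
    ∃ (f : P.syzygy (n + 1) ⟶ ModuleCat.of R (P.F n)) (g : ModuleCat.of R (P.F n) ⟶ P.syzygy n)
      (h : f ≫ g = 0), (ShortComplex.mk f g h).ShortExact := by
  have key {A B C : Type u} [AddCommGroup A] [AddCommGroup B] [AddCommGroup C]
      [Module R A] [Module R B] [Module R C] (f : A →ₗ[R] B) (g : B →ₗ[R] C)
      (hfg : Function.Exact f g) :
      ∃ (i : ModuleCat.of R (LinearMap.ker f) ⟶ ModuleCat.of R A)
        (p : ModuleCat.of R A ⟶ ModuleCat.of R (LinearMap.ker g))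
        (h : i ≫ p = 0), (ShortComplex.mk i p h).ShortExact :=
    ⟨_, _, _, shortExact_of_exact (LinearMap.ker f).injective_subtype
      (g := f.codRestrict (LinearMap.ker g) fun a => (hfg _).2 ⟨a, rfl⟩)
      (fun a => ⟨fun h => ⟨⟨a, congrArg Subtype.val h⟩, rfl⟩, by
        rintro ⟨b, rfl⟩
        exact Subtype.ext b.2⟩)
      (fun ⟨b, hb⟩ => by
        obtain ⟨a, rfl⟩ := (hfg b).1 hb
        exact ⟨a, rfl⟩)⟩
  match n with
  | 0 => exact ⟨_, _, _, shortExact_of_exact (LinearMap.ker P.ε).injective_subtype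
      (LinearMap.exact_subtype_ker_map P.ε) P.surjective_ε⟩
  | 1 => exact key _ _ P.exact_zero
  | n + 2 => exact key _ _ (P.exact_succ n)

lemma finite_syzygy [IsNoetherianRing R] [Module.Finite R M] (n : ℕ) :
    Module.Finite R (P.syzygy n) :=
  match n with
  | 0 => ‹Module.Finite R M›
  | 1 => inferInstanceAs (Module.Finite R (LinearMap.ker P.ε))
  | n + 2 => inferInstanceAs (Module.Finite R (LinearMap.ker (P.d n)))

lemma extColimVanishes_syzygy {a : Ideal R} {g : ℕ∞}
    (hg : ∀ i : ℕ, i < g → ExtColimVanishes a i (ModuleCat.of R R)) (n i : ℕ) (hn : i < n)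
    (hi : i < g) : ExtColimVanishes a i (P.syzygy n) := by
  induction n generalizing i with
  | zero => simp at hn
  | succ n ih =>
    obtain ⟨f, p, h, hS⟩ := P.exists_shortExact n
    have hF := (hg i hi).free (P.F n)
    cases i with
    | zero => exact ExtColimVanishes.left_zero hS hF
    | succ i =>
      have hi' : (i : ℕ∞) < g := lt_of_le_of_lt (by exact_mod_cast Nat.le_succ i) hi
      exact ExtColimVanishes.left hS (ih i (by lia) hi') hF

end FiniteFreeResolution

variable {a : Ideal R}

lemma nonvanishingAt_iff [IsNoetherianRing R] {N : ModuleCat.{u} R} {i : ℕ} :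
    NonvanishingAt a N i ↔ ¬ ExtColimVanishes a i N := by
  rw [extColimVanishes_iff_isZero, NonvanishingAt]

lemma not_nonvanishingAt_of_lt_grade {N : ModuleCat.{u} R} {i : ℕ} (hi : i < grade a N) :
    ¬ NonvanishingAt a N i :=
  fun h => hi.not_ge (iInf₂_le i h)

lemma le_cd_of_nonvanishingAt {N : ModuleCat.{u} R} {i : ℕ} (hi : NonvanishingAt a N i) :
    ((i : ℕ∞) : WithBot ℕ∞) ≤ cd a N :=
  le_iSup₂ (f := fun (i : ℕ) (_ : NonvanishingAt a N i) => ((i : ℕ∞) : WithBot ℕ∞)) i hi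

lemma cd_congr {N N' : ModuleCat.{u} R}
    (h : ∀ i, NonvanishingAt a N i ↔ NonvanishingAt a N' i) : cd a N = cd a N' := by
  simp only [cd, h]

lemma min_le_grade_syzygy [IsNoetherianRing R] {M : Type u} [AddCommGroup M] [Module R M]
    (P : FiniteFreeResolution R M) (n : ℕ) :
    min (n : ℕ∞) (grade a (ModuleCat.of R R)) ≤ grade a (P.syzygy n) := by
  refine le_iInf₂ fun i hi => ?_
  by_contra! hlt
  rw [lt_min_iff] at hlt
  refine nonvanishingAt_iff.1 hi (P.extColimVanishes_syzygy (fun j hj => ?_) n i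
    (by exact_mod_cast hlt.1) hlt.2)
  exact not_not.1 (nonvanishingAt_iff.not.1 (not_nonvanishingAt_of_lt_grade hj))

lemma isMaximalRCM_syzygy [IsNoetherianRing R] {M : Type u} [AddCommGroup M] [Module R M]
    [Module.Finite R M] (P : FiniteFreeResolution R M) (hR : IsRCM a (ModuleCat.of R R)) {n : ℕ}
    (hn : cd a (ModuleCat.of R R) ≤ ((n : ℕ∞) : WithBot ℕ∞))
    (h : a • (⊤ : Submodule R (P.syzygy n)) ≠ ⊤) : IsMaximalRCM a (P.syzygy n) := by
  have hfin := P.finite_syzygy n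
  obtain ⟨d, hd, huniq⟩ := hR.existsUnique
  have hdn : d ≤ n := by exact_mod_cast (le_cd_of_nonvanishingAt hd).trans hn
  have hR' (i : ℕ) (hi : i ≠ d) : ExtColimVanishes a i (ModuleCat.of R R) :=
    not_not.1 fun H => hi (huniq i (nonvanishingAt_iff.2 H))
  have heq {i : ℕ} (hi : NonvanishingAt a (P.syzygy n) i) : i = d := by
    by_contra hne
    refine nonvanishingAt_iff.1 hi ?_
    obtain hlt | hgt := lt_or_gt_of_ne hne
    -- Here `n ≥ d` is essential: `i < d ≤ n` leaves enough syzygy steps to shift down to degree 0.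
    · exact P.extColimVanishes_syzygy (g := d)
        (fun j hj => hR' j (by exact_mod_cast hj.ne)) n i (by lia) (by exact_mod_cast hlt)
    · exact extColimVanishes_of_forall_gt (fun j hj => hR' j hj.ne') hgt (P.syzygy n)
  obtain ⟨i, hi⟩ := exists_not_extColimVanishes h
  have hi' : NonvanishingAt a (P.syzygy n) i := nonvanishingAt_iff.2 hi
  obtain rfl := heq hi'
  refine ⟨?_, ⟨hfin, i, hi', fun j hj => heq hj⟩, cd_congr fun j => ?_⟩
  · by_contra H
    rw [not_nontrivial_iff_subsingleton] at H
    exact h (Subsingleton.elim _ _)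
  · exact ⟨fun hj => heq hj ▸ hd, fun hj => huniq j hj ▸ hi'⟩

end Syzygy
end RelativeCM

theorem proposition2p2 {R : Type u} [CommRing R] [IsNoetherianRing R] (a : Ideal R) (ha : a ≠ ⊤)
    {M : Type u} [AddCommGroup M] [Module R M] [Module.Finite R M]
    (P : RelativeCM.FiniteFreeResolution R M) :
    (∀ n : ℕ, min (n : ℕ∞) (RelativeCM.grade a (ModuleCat.of R R)) ≤
      RelativeCM.grade a (P.syzygy n)) ∧
    (RelativeCM.IsRCM a (ModuleCat.of R R) →
      (∀ n : ℕ, RelativeCM.cd a (ModuleCat.of R R) ≤ ((n : ℕ∞) : WithBot ℕ∞) →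
        a • (⊤ : Submodule R (P.syzygy n)) = ⊤ ∨ RelativeCM.IsMaximalRCM a (P.syzygy n)) ∧
      (a ≤ Ring.jacobson R →
        ∀ n : ℕ, RelativeCM.cd a (ModuleCat.of R R) ≤ ((n : ℕ∞) : WithBot ℕ∞) →
          Subsingleton (P.syzygy n) ∨ RelativeCM.IsMaximalRCM a (P.syzygy n))) := by
  have main (hR : RelativeCM.IsRCM a (ModuleCat.of R R)) (n : ℕ)
      (hn : RelativeCM.cd a (ModuleCat.of R R) ≤ ((n : ℕ∞) : WithBot ℕ∞)) :
      a • (⊤ : Submodule R (P.syzygy n)) = ⊤ ∨ RelativeCM.IsMaximalRCM a (P.syzygy n) :=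
    or_iff_not_imp_left.2 fun h => RelativeCM.isMaximalRCM_syzygy P hR hn h
  refine ⟨RelativeCM.min_le_grade_syzygy P, fun hR => ⟨main hR, fun hJ n hn => ?_⟩⟩
  refine (main hR n hn).imp_left fun h => ?_
  have := P.finite_syzygy n
  rw [← Submodule.subsingleton_iff R, ← subsingleton_iff_bot_eq_top, eq_comm]
  exact Submodule.eq_bot_of_le_smul_of_le_jacobson_bot a ⊤ Module.Finite.fg_top h.ge
    (by rwa [Ideal.jacobson_bot])
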